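/- Let $\mu$ be a regular cardinal and let $\mathbf{K}$ be a $\mu$-AEC. Regard $\mathbf{K}$ as a category whose morphisms are the $\mathbf{K}$-embeddings, and assume that it has a stable independence relation, that is, a class of commutative squares (amalgams of spans), closed under equivalence of amalgams, that is symmetric, left and right transitive, has existence and uniqueness, and is left and right accessible (the category whose objects are the morphisms of $\mathbf{K}$ and whose morphisms are the independent squares is accessible, and likewise for the dual relation). For $M \in \mathbf{K}$ and an ordinal $\alpha$, let $\mathrm{gS}^{<\alpha}(M)$ be the set of Galois types over $M$ of sequences of length less than $\alpha$. Then: 1. (Stability for Galois types) For every ordinal $\alpha$ there is a proper class $S_\alpha$ of cardinals such that for every $\lambda \in S_\alpha$ and every $M \in \mathbf{K}$ whose universe has cardinality $\lambda$, $|\mathrm{gS}^{<\alpha}(M)| \le \lambda$, and $|\mathrm{gS}^{<\alpha}(M)| = \lambda$ if $\alpha \ge 2$. 2. (Tameness) For every ordinal $\alpha$ there is a cardinal $\lambda$ such that for every $M \in \mathbf{K}$ and all $p, q \in \mathrm{gS}^{<\alpha}(M)$, $p = q$ if and only if $p \upharpoonright A = q \upharpoonright A$ for every subset $A$ of the universe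 of $M$ with $|A| < \lambda$. -/

import Mathlib

universe v u

namespace MuAEC

open CategoryTheory Cardinal

/-! ### Structures in a `μ`-ary vocabulary -/

/-- A `μ`-ary vocabulary: a set of function symbols and a set of relation symbols, each with an
arity, which is an index set of cardinality less than `μ`. -/
structure Vocabulary (μ : Cardinal.{u}) where
  Fun : Type u
  Rel : Type u
  funArity : Fun → Type u
  relArity : Rel → Type u
  funArity_lt : ∀ s, #(funArity s) < μ
  relArity_lt : ∀ r, #(relArity r) < μ

/-- The number of symbols of a vocabulary. -/
def Vocabulary.card {μ : Cardinal.{u}} (τ : Vocabulary μ) : Cardinal.{u} :=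
  #τ.Fun + #τ.Rel

/-- A `τ`-structure. -/
structure Str {μ : Cardinal.{u}} (τ : Vocabulary μ) where
  carrier : Type u
  funMap : ∀ s : τ.Fun, (τ.funArity s → carrier) → carrier
  relMap : ∀ r : τ.Rel, (τ.relArity r → carrier) → Prop

/-- An embedding of `τ`-structures: an injective map that commutes with the functions and both
preserves and reflects the relations. Equivalently, an isomorphism of `M` onto a substructure
of `N`. -/
@[ext]
structure Emb {μ : Cardinal.{u}} {τ : Vocabulary μ} (M N : Str τ) where
  toFun : M.carrier → N.carrier
  injective : Function.Injective toFun
  map_fun : ∀ (s : τ.Fun) (x : τ.funArity s → M.carrier),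
    toFun (M.funMap s x) = N.funMap s (fun i => toFun (x i))
  map_rel : ∀ (r : τ.Rel) (x : τ.relArity r → M.carrier),
    M.relMap r x ↔ N.relMap r (fun i => toFun (x i))

/-- The identity embedding. -/
def Emb.id {μ : Cardinal.{u}} {τ : Vocabulary μ} (M : Str τ) : Emb M M where
  toFun x := x
  injective := Function.injective_id
  map_fun _ _ := rfl
  map_rel _ _ := Iff.rfl

/-- The composite `M → N → P` of two embeddings. -/
def Emb.comp {μ : Cardinal.{u}} {τ : Vocabulary μ} {M N P : Str τ} (f : Emb M N) (g : Emb N P) :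
    Emb M P where
  toFun x := g.toFun (f.toFun x)
  injective := g.injective.comp f.injective
  map_fun s x := by rw [f.map_fun, g.map_fun]
  map_rel r x := (f.map_rel r x).trans (g.map_rel r _)

/-! ### Abstract classes and `μ`-AECs -/

/-- An abstract class `(K, ≤)` of `τ`-structures, given by its members and its `K`-embeddings,
that is, the embeddings `f : M → N` between members such that `f[M] ≤ N`. In particular, for a
substructure `M` of `N`, the relation `M ≤ N` says that the inclusion of `M` into `N` is a
`K`-embedding. In these terms, that `≤` is a partial order on `K` that refines the substructure
relation, and that `K` and `≤` are closed under isomorphisms, means that the `K`-embeddings form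
a subcategory of the category of `τ`-structures and embeddings that contains, with each of its
objects, all isomorphisms from that object onto a `τ`-structure. -/
structure AbstractClass {μ : Cardinal.{u}} (τ : Vocabulary μ) where
  mem : Str τ → Prop
  isEmb : ∀ {M N : Str τ}, Emb M N → Prop
  mem_left : ∀ {M N : Str τ} (f : Emb M N), isEmb f → mem M
  mem_right : ∀ {M N : Str τ} (f : Emb M N), isEmb f → mem N
  isEmb_of_surjective : ∀ {M N : Str τ} (f : Emb M N), mem M → Function.Surjective f.toFun →
    isEmb f
  isEmb_comp : ∀ {M N P : Str τ} (f : Emb M N) (g : Emb N P), isEmb f → isEmb g →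
    isEmb (f.comp g)

/-- A partially ordered set is `μ`-directed if each of its subsets of cardinality less than `μ`
has an upper bound. -/
def IsCardDirected (μ : Cardinal.{u}) (I : Type u) [PartialOrder I] : Prop :=
  ∀ s : Set I, #s < μ → BddAbove s

/-- `M` is the union (up to isomorphism) of the system `(X i)` with transition maps `f` along the
embeddings `g i : X i → M`. -/
def IsUnion {μ : Cardinal.{u}} {τ : Vocabulary μ} {I : Type u} [PartialOrder I] (X : I → Str τ)
    (f : ∀ i j, i ≤ j → Emb (X i) (X j)) (M : Str τ) (g : ∀ i, Emb (X i) M) : Prop :=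
  (∀ i j (h : i ≤ j), (f i j h).comp (g j) = g i) ∧
    ∀ x : M.carrier, ∃ i, ∃ y : (X i).carrier, (g i).toFun y = x

/-- The axioms of a `μ`-abstract elementary class (for a regular cardinal `μ`). -/
structure AbstractClass.IsMuAEC {μ : Cardinal.{u}} {τ : Vocabulary μ} (K : AbstractClass τ) :
    Prop where
  /-- Coherence: if `M₀ ⊆ M₁ ≤ M₂` and `M₀ ≤ M₂`, then `M₀ ≤ M₁`. -/
  coherence : ∀ {M₀ M₁ M₂ : Str τ} (f : Emb M₀ M₁) (g : Emb M₁ M₂),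
    K.isEmb g → K.isEmb (f.comp g) → K.isEmb f
  /-- Chain axioms: the union `M` of a `μ`-directed system of members is a member, the members of
  the system are below `M`, and `M` is below each member `N` that they are all below. -/
  chain : ∀ (I : Type u) [PartialOrder I], IsCardDirected μ I →
    ∀ (X : I → Str τ) (f : ∀ i j, i ≤ j → Emb (X i) (X j)), (∀ i j h, K.isEmb (f i j h)) →
    ∀ (M : Str τ) (g : ∀ i, Emb (X i) M), IsUnion X f M g →
      K.mem M ∧ (∀ i, K.isEmb (g i)) ∧
        ∀ (N : Str τ) (h : Emb M N), (∀ i, K.isEmb ((g i).comp h)) → K.isEmb h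
  /-- The Löwenheim-Skolem-Tarski axiom. -/
  lst : ∃ lam : Cardinal.{u}, lam ^< μ = lam ∧ τ.card + μ ≤ lam ∧
    ∀ M : Str τ, K.mem M → ∀ A : Set M.carrier, ∃ (M₀ : Str τ) (f : Emb M₀ M),
      K.isEmb f ∧ A ⊆ Set.range f.toFun ∧ #M₀.carrier ≤ #A ^< μ + lam

/-- The members of an abstract class, as the objects of a category. -/
structure AbstractClass.Obj {μ : Cardinal.{u}} {τ : Vocabulary μ} (K : AbstractClass τ) where
  str : Str τ
  mem : K.mem str

/-- The universe of a member of an abstract class. -/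
abbrev AbstractClass.Obj.U {μ : Cardinal.{u}} {τ : Vocabulary μ} {K : AbstractClass τ}
    (M : K.Obj) : Type u :=
  M.str.carrier

/-- The morphisms between members of an abstract class: the `K`-embeddings. -/
@[ext]
structure AbstractClass.Hom {μ : Cardinal.{u}} {τ : Vocabulary μ} {K : AbstractClass τ}
    (M N : K.Obj) where
  emb : Emb M.str N.str
  isEmb : K.isEmb emb

/-- The category of members of an abstract class and `K`-embeddings. -/
instance AbstractClass.category {μ : Cardinal.{u}} {τ : Vocabulary μ} (K : AbstractClass τ) :
    Category.{u} K.Obj where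
  Hom M N := AbstractClass.Hom M N
  id M := ⟨Emb.id M.str, K.isEmb_of_surjective _ M.mem Function.surjective_id⟩
  comp f g := ⟨f.emb.comp g.emb, K.isEmb_comp _ _ f.isEmb g.isEmb⟩

/-- The underlying function of a `K`-embedding. -/
def AbstractClass.fn {μ : Cardinal.{u}} {τ : Vocabulary μ} {K : AbstractClass τ} {M N : K.Obj}
    (f : M ⟶ N) : M.U → N.U :=
  Emb.toFun (AbstractClass.Hom.emb f)

theorem AbstractClass.fn_injective {μ : Cardinal.{u}} {τ : Vocabulary μ} {K : AbstractClass τ}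
    {M N : K.Obj} (f : M ⟶ N) : Function.Injective (AbstractClass.fn f) :=
  Emb.injective (AbstractClass.Hom.emb f)

theorem AbstractClass.fn_comp {μ : Cardinal.{u}} {τ : Vocabulary μ} {K : AbstractClass τ}
    {M N P : K.Obj} (f : M ⟶ N) (g : N ⟶ P) (x : M.U) :
    AbstractClass.fn (f ≫ g) x = AbstractClass.fn g (AbstractClass.fn f x) :=
  rfl

/-! ### Galois types -/

/-- A representative `(M, a, N)` of a Galois type over `M`: an extension `f : M → N` and a
sequence `a` of length `β` of elements of `N`. -/
structure PreType {μ : Cardinal.{u}} {τ : Vocabulary μ} {K : AbstractClass τ} (M : K.Obj)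
    (β : Ordinal.{u}) where
  N : K.Obj
  f : M ⟶ N
  a : β.ToType → N.U

/-- `(M, a, N) ∼ (M, a', N')`: there is an amalgam of `N` and `N'` over `M` that identifies the
sequences `a` and `a'`. -/
def PreType.Equiv {μ : Cardinal.{u}} {τ : Vocabulary μ} {K : AbstractClass τ} {M : K.Obj}
    {β : Ordinal.{u}} (p q : PreType M β) : Prop :=
  ∃ (N : K.Obj) (g : p.N ⟶ N) (g' : q.N ⟶ N), p.f ≫ g = q.f ≫ g' ∧
    ∀ i, AbstractClass.fn g (p.a i) = AbstractClass.fn g' (q.a i)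

/-- The Galois types over `M` of length `β`: the classes of the equivalence relation generated
by `∼` (as `∼` is reflexive and symmetric, this is its transitive closure). -/
def GaloisType {μ : Cardinal.{u}} {τ : Vocabulary μ} {K : AbstractClass τ} (M : K.Obj)
    (β : Ordinal.{u}) : Type (u + 1) :=
  Quot (PreType.Equiv (M := M) (β := β))

/-- A representative `(A, a, N)` of a Galois type over a set `A`: a member `N` of the class that
contains `A`, and a sequence `a` of length `β` of elements of `N`. -/
structure SetPreType {μ : Cardinal.{u}} {τ : Vocabulary μ} (K : AbstractClass τ) (A : Type u)
    (β : Ordinal.{u}) where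
  N : K.Obj
  incl : A → N.U
  incl_injective : Function.Injective incl
  a : β.ToType → N.U

/-- `(A, a, N) ∼ (A, a', N')`: there are `K`-embeddings of `N` and `N'` into a member of the
class that agree on `A` and identify the sequences `a` and `a'`. -/
def SetPreType.Equiv {μ : Cardinal.{u}} {τ : Vocabulary μ} {K : AbstractClass τ} {A : Type u}
    {β : Ordinal.{u}} (p q : SetPreType K A β) : Prop :=
  ∃ (N : K.Obj) (g : p.N ⟶ N) (g' : q.N ⟶ N),
    (∀ x, AbstractClass.fn g (p.incl x) = AbstractClass.fn g' (q.incl x)) ∧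
    ∀ i, AbstractClass.fn g (p.a i) = AbstractClass.fn g' (q.a i)

/-- The Galois types over the set `A` of length `β`. -/
def SetGaloisType {μ : Cardinal.{u}} {τ : Vocabulary μ} (K : AbstractClass τ) (A : Type u)
    (β : Ordinal.{u}) : Type (u + 1) :=
  Quot (SetPreType.Equiv (K := K) (A := A) (β := β))

/-- The restriction of a Galois type over `M` to a set `A` of elements of `M`. -/
def GaloisType.restrict {μ : Cardinal.{u}} {τ : Vocabulary μ} {K : AbstractClass τ} {M : K.Obj}
    {β : Ordinal.{u}} (A : Set M.U) : GaloisType M β → SetGaloisType K A β :=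
  Quot.map
    (fun p =>
      { N := p.N
        incl := fun x => AbstractClass.fn p.f x
        incl_injective := (AbstractClass.fn_injective p.f).comp Subtype.val_injective
        a := p.a })
    (fun p q ⟨N, g, g', h, h'⟩ => ⟨N, g, g',
      fun x => by
        simp only [← AbstractClass.fn_comp, h], h'⟩)

/-- The Galois types over `M` of length less than `α`. -/
def GaloisTypeLT {μ : Cardinal.{u}} {τ : Vocabulary μ} {K : AbstractClass τ} (M : K.Obj)
    (α : Ordinal.{u}) : Type (u + 1) :=
  Σ β : Set.Iio α, GaloisType M β.1

/-- The restriction of a Galois type over `M` of length less than `α` to a set `A` of elements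
of `M`. -/
def GaloisTypeLT.restrict {μ : Cardinal.{u}} {τ : Vocabulary μ} {K : AbstractClass τ} {M : K.Obj}
    {α : Ordinal.{u}} (A : Set M.U) (p : GaloisTypeLT M α) :
    Σ β : Set.Iio α, SetGaloisType K A β.1 :=
  ⟨p.1, p.2.restrict A⟩

/-! ### Independence relations on a category -/

/-- An amalgam of the span `(f₁ : M₀ → M₁, f₂ : M₀ → M₂)`. -/
structure Amalgam {C : Type v} [Category.{u} C] {M₀ M₁ M₂ : C} (f₁ : M₀ ⟶ M₁) (f₂ : M₀ ⟶ M₂) where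
  N : C
  g₁ : M₁ ⟶ N
  g₂ : M₂ ⟶ N
  w : f₁ ≫ g₁ = f₂ ≫ g₂

/-- The same amalgam, with the two sides exchanged. -/
def Amalgam.swap {C : Type v} [Category.{u} C] {M₀ M₁ M₂ : C} {f₁ : M₀ ⟶ M₁} {f₂ : M₀ ⟶ M₂}
    (a : Amalgam f₁ f₂) : Amalgam f₂ f₁ :=
  ⟨a.N, a.g₂, a.g₁, a.w.symm⟩

/-- The relation `∼*` between two amalgams of the same span: both map into a third object so
that the two maps from `M₁`, and the two maps from `M₂`, become equal. -/
def Amalgam.EquivStar {C : Type v} [Category.{u} C] {M₀ M₁ M₂ : C} {f₁ : M₀ ⟶ M₁} {f₂ : M₀ ⟶ M₂}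
    (a b : Amalgam f₁ f₂) : Prop :=
  ∃ (N : C) (ga : a.N ⟶ N) (gb : b.N ⟶ N), a.g₁ ≫ ga = b.g₁ ≫ gb ∧ a.g₂ ≫ ga = b.g₂ ≫ gb

/-- Equivalence `∼` of amalgams: the transitive closure of `∼*`. -/
def Amalgam.Equiv {C : Type v} [Category.{u} C] {M₀ M₁ M₂ : C} {f₁ : M₀ ⟶ M₁} {f₂ : M₀ ⟶ M₂}
    (a b : Amalgam f₁ f₂) : Prop :=
  Relation.TransGen Amalgam.EquivStar a b

theorem Amalgam.EquivStar.swap {C : Type v} [Category.{u} C] {M₀ M₁ M₂ : C} {f₁ : M₀ ⟶ M₁}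
    {f₂ : M₀ ⟶ M₂} {a b : Amalgam f₁ f₂} (h : a.EquivStar b) : a.swap.EquivStar b.swap := by
  obtain ⟨N, ga, gb, h₁, h₂⟩ := h
  exact ⟨N, ga, gb, h₂, h₁⟩

theorem Amalgam.Equiv.swap {C : Type v} [Category.{u} C] {M₀ M₁ M₂ : C} {f₁ : M₀ ⟶ M₁}
    {f₂ : M₀ ⟶ M₂} {a b : Amalgam f₁ f₂} (h : a.Equiv b) : a.swap.Equiv b.swap := by
  induction h with
  | single h => exact Relation.TransGen.single h.swap
  | tail _ h ih => exact Relation.TransGen.tail ih h.swap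

/-- An independence relation on `C`: a class of amalgamation diagrams `(f₁, f₂, g₁, g₂)` that is
closed under equivalence of amalgams. -/
structure IndepRel (C : Type v) [Category.{u} C] where
  indep : ∀ {M₀ M₁ M₂ : C} {f₁ : M₀ ⟶ M₁} {f₂ : M₀ ⟶ M₂}, Amalgam f₁ f₂ → Prop
  closed : ∀ {M₀ M₁ M₂ : C} {f₁ : M₀ ⟶ M₁} {f₂ : M₀ ⟶ M₂} (a b : Amalgam f₁ f₂),
    a.Equiv b → indep a → indep b

namespace IndepRel

variable {C : Type v} [Category.{u} C]

/-- The dual independence relation. -/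
def dual (I : IndepRel C) : IndepRel C where
  indep a := I.indep a.swap
  closed a b h := I.closed a.swap b.swap h.swap

/-- Symmetry: the relation agrees with its dual. -/
def Symmetric (I : IndepRel C) : Prop :=
  ∀ {M₀ M₁ M₂ : C} {f₁ : M₀ ⟶ M₁} {f₂ : M₀ ⟶ M₂} (a : Amalgam f₁ f₂),
    I.indep a ↔ I.dual.indep a

/-- Existence: every span has an independent amalgam. -/
def Existence (I : IndepRel C) : Prop :=
  ∀ {M₀ M₁ M₂ : C} (f₁ : M₀ ⟶ M₁) (f₂ : M₀ ⟶ M₂), ∃ a : Amalgam f₁ f₂, I.indep a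

/-- Uniqueness: any two independent amalgams of the same span are equivalent. -/
def Uniqueness (I : IndepRel C) : Prop :=
  ∀ {M₀ M₁ M₂ : C} {f₁ : M₀ ⟶ M₁} {f₂ : M₀ ⟶ M₂} (a b : Amalgam f₁ f₂),
    I.indep a → I.indep b → a.Equiv b

/-- Right transitivity: if in the commutative diagram with rows `M₁ → M₃ → M₅` and
`M₀ → M₂ → M₄` both squares are independent, then so is the outer rectangle. -/
def RightTransitive (I : IndepRel C) : Prop :=
  ∀ {M₀ M₁ M₂ M₃ M₄ M₅ : C} (f₀₁ : M₀ ⟶ M₁) (f₀₂ : M₀ ⟶ M₂) (f₁₃ : M₁ ⟶ M₃) (f₂₃ : M₂ ⟶ M₃)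
    (f₂₄ : M₂ ⟶ M₄) (f₃₅ : M₃ ⟶ M₅) (f₄₅ : M₄ ⟶ M₅)
    (w : f₀₁ ≫ f₁₃ = f₀₂ ≫ f₂₃) (w' : f₂₃ ≫ f₃₅ = f₂₄ ≫ f₄₅),
    I.indep (⟨M₃, f₁₃, f₂₃, w⟩ : Amalgam f₀₁ f₀₂) →
    I.indep (⟨M₅, f₃₅, f₄₅, w'⟩ : Amalgam f₂₃ f₂₄) →
    I.indep (⟨M₅, f₁₃ ≫ f₃₅, f₄₅, by
      rw [← Category.assoc, w, Category.assoc, w', Category.assoc]⟩ : Amalgam f₀₁ (f₀₂ ≫ f₂₄))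

/-- Left transitivity: right transitivity of the dual. -/
def LeftTransitive (I : IndepRel C) : Prop :=
  I.dual.RightTransitive

theorem Existence.dual {I : IndepRel C} (h : I.Existence) : I.dual.Existence := by
  intro M₀ M₁ M₂ f₁ f₂
  obtain ⟨a, ha⟩ := h f₂ f₁
  exact ⟨a.swap, ha⟩

/-- The independent squares, viewed as a class of morphisms in the category of morphisms of `C`:
a morphism `(h₁, h₂)` from `f : M₁ → M₂` to `g : N₁ → N₂` belongs to the class if `(h₂, g)` is an
independent amalgam of the span `(f, h₁)`. -/
def nf (I : IndepRel C) : MorphismProperty (Arrow C) :=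
  fun f g h => I.indep (⟨g.right, h.right, g.hom, h.w.symm⟩ : Amalgam f.hom h.left)

theorem nf_isMultiplicative (I : IndepRel C) (hE : I.Existence) (hT : I.RightTransitive) :
    I.nf.IsMultiplicative where
  id_mem f := by
    obtain ⟨a, ha⟩ := hE f.hom (𝟙 f.left)
    refine I.closed a _ (Relation.TransGen.single ⟨a.N, 𝟙 _, a.g₁, ?_, ?_⟩) ha
    · exact (Category.comp_id _).trans (Category.id_comp _).symm
    · exact (Category.comp_id _).trans ((Category.id_comp _).symm.trans a.w.symm)
  comp_mem {f g k} h h' H H' :=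
    hT f.hom h.left h.right g.hom h'.left h'.right k.hom h.w.symm h'.w.symm H H'

/-- The category `K_NF` of a right transitive independence relation with existence: its objects
are the morphisms of `C`, its morphisms the independent squares. -/
abbrev KNF (I : IndepRel C) (hE : I.Existence) (hT : I.RightTransitive) : Type (max v u) :=
  @WideSubcategory (Arrow C) _ I.nf (I.nf_isMultiplicative hE hT)

/-- Accessibility of the category `K_NF`: for some regular cardinal `κ` it has `κ`-filtered
colimits and a set of `κ`-presentable objects of which every object is a `κ`-filtered colimit.
(Sets are the `u`-small types.) -/
def KNFAccessible (I : IndepRel C) (hE : I.Existence) (hT : I.RightTransitive) : Prop :=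
  @IsAccessibleCategory.{u} (I.KNF hE hT)
    (@WideSubcategory.category (Arrow C) _ I.nf (I.nf_isMultiplicative hE hT))

/-- A stable independence relation: symmetric, (left and right) transitive, (left and right)
accessible, with existence and uniqueness. -/
structure IsStable (I : IndepRel C) : Prop where
  symmetric : I.Symmetric
  rightTransitive : I.RightTransitive
  leftTransitive : I.LeftTransitive
  existence : I.Existence
  uniqueness : I.Uniqueness
  rightAccessible : I.KNFAccessible existence rightTransitive
  leftAccessible : I.dual.KNFAccessible existence.dual leftTransitive

end IndepRel

end MuAEC

/-! Everything rests on a local character statement, `exists_local_character`: for each `θ` there is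
a set of morphisms `G i` such that any `θ` elements of the codomain of any `f` lie in the image of
an independent square from some `G i` to `f`. It comes from accessibility of `K_NF`: each `f` is a
highly directed colimit in `K_NF` of objects from a set, and such a colimit is covered by its
stages, on domains and on codomains.

Stability: a short sequence `a` over `M` comes from some `G i`, placed independently from `M`. By
uniqueness its type over `M` depends only on `i`, the map from the domain of `G i` to `M`, and the
preimage of `a` in the codomain of `G i`. If `λ ^ ν = λ` for a `ν` bounding the sizes involved,
there are at most `λ` such data.

Tameness: put two sequences `a`, `b` in one extension `N` of `M` and cover both by an independent
square over a small `M₀`. If their types over the image of `M₀` agree, some `u, v : N ⟶ Q` agree on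
`M₀` and send `a`, `b` to the same sequence. Transitivity yields independent amalgams of `M` with
`Q` over `M₀` realizing the two types by that sequence, and uniqueness identifies them
(`galoisType_eq_of_restrict_eq`). -/

namespace MuAEC

open CategoryTheory Cardinal Limits CardinalDirectedPoset

/-! ### Raising the index of accessibility. -/

section Category

/-- The poset of `κ₁`-directed subsets of cardinality `< κ₂` of a poset. -/
abbrev DirectedSubset (κ₁ κ₂ : Cardinal.{u}) [Fact κ₁.IsRegular] (J : Type u) [PartialOrder J] :
    Type u :=
  {S : Set J // IsCardinalFiltered S κ₁ ∧ HasCardinalLT S κ₂}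

/-- This makes `κ₁` sharply smaller than `ν⁺`: a set of size at most `ν` has at most `ν ^ κ₁ ≤ ν`
subsets of size less than `κ₁`, so all of them may be taken. -/
theorem exists_cofinal_of_power_le {κ₁ ν : Cardinal.{u}} (hν : ν ^ κ₁ ≤ ν) (h₀ : ℵ₀ ≤ ν)
    (X : Type u) (hX : HasCardinalLT X (Order.succ ν)) :
    ∃ Y : Set (SetCardinalLT κ₁ X), HasCardinalLT Y (Order.succ ν) ∧ IsCofinal Y := by
  refine ⟨Set.univ, ?_, IsCofinal.univ⟩
  rw [hasCardinalLT_iff_cardinal_mk_lt, Order.lt_succ_iff] at hX ⊢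
  rw [mk_univ]
  calc #(SetCardinalLT κ₁ X) ≤ #{t : Set X // #t ≤ κ₁} :=
        mk_subtype_le_of_subset fun s hs => (by
          rw [hasCardinalLT_iff_cardinal_mk_lt] at hs
          exact hs.le)
    _ ≤ max #X ℵ₀ ^ κ₁ := mk_bounded_set_le X κ₁
    _ ≤ ν ^ κ₁ := power_le_power_right (max_le hX h₀)
    _ ≤ ν := hν

theorem power_two_power_le {a b : Cardinal.{u}} (hb : ℵ₀ ≤ b) (hab : a ≤ b) :
    ((2 : Cardinal.{u}) ^ b) ^ a ≤ 2 ^ b := by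
  rw [← power_mul]
  refine power_le_power_left two_ne_zero ?_
  exact (mul_le_mul_right hab b).trans (mul_eq_self hb).le

variable {κ₁ κ₂ : Cardinal.{u}} [Fact κ₁.IsRegular]

/-- By regularity a union of fewer than `κ₂` members is still of size less than `κ₂`; the cofinality
hypothesis lets it be closed off to a `κ₁`-directed subset of that size. -/
theorem DirectedSubset.isCardinalFiltered [Fact κ₂.IsRegular] (h : κ₁ < κ₂)
    (hY : ∀ X : Type u, HasCardinalLT X κ₂ →
      ∃ Y : Set (SetCardinalLT κ₁ X), HasCardinalLT Y κ₂ ∧ IsCofinal Y)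
    {J : Type u} [PartialOrder J] [IsCardinalFiltered J κ₁] :
    IsCardinalFiltered (DirectedSubset κ₁ κ₂ J) κ₂ := by
  refine isCardinalFiltered_preorder _ _ fun K s hK => ?_
  obtain ⟨B, hB, hB₁, hB₂⟩ :=
    SharplyLT.exists_isCardinalFiltered_set_of_exists_cofinal h hY (⋃ k, (s k).1)
      (hasCardinalLT_iUnion _ (by rwa [hasCardinalLT_iff_cardinal_mk_lt]) fun k => (s k).2.2)
  exact ⟨⟨B, hB₁, hB₂⟩, fun k => (Set.subset_iUnion (fun k => (s k).1) k).trans hB⟩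

/-- A singleton, as a directed subset. -/
def DirectedSubset.single (κ₁ κ₂ : Cardinal.{u}) [Fact κ₁.IsRegular] [Fact κ₂.IsRegular]
    {J : Type u} [PartialOrder J] (j : J) : DirectedSubset κ₁ κ₂ J :=
  ⟨{j}, isCardinalFiltered_preorder _ _ fun _ _ _ => ⟨⟨j, rfl⟩, fun k => by simp⟩,
    hasCardinalLT_of_finite _ _ (IsRegular.aleph0_le Fact.out)⟩

variable {C : Type v} [Category.{u} C] {J : Type u} [PartialOrder J] (D : J ⥤ C)

/-- The restriction of a diagram to a directed subset of its indexing poset. -/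
abbrev DirectedSubset.diag (S : DirectedSubset κ₁ κ₂ J) : S.1 ⥤ C :=
  (Subtype.mono_coe (· ∈ S.1)).functor ⋙ D

variable [HasCardinalFilteredColimits.{u} C κ₁]

instance (S : DirectedSubset κ₁ κ₂ J) : HasColimit (DirectedSubset.diag D S) := by
  have := S.2.1
  have := HasCardinalFilteredColimits.hasColimitsOfShape (κ := κ₁) C S.1
  infer_instance

/-- The transition map between the colimits over two directed subsets. -/
noncomputable def DirectedSubset.map {S T : DirectedSubset κ₁ κ₂ J} (h : S ≤ T) :
    colimit (DirectedSubset.diag D S) ⟶ colimit (DirectedSubset.diag D T) :=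
  colimit.desc (DirectedSubset.diag D S)
    { pt := _
      ι :=
        { app := fun j => colimit.ι (DirectedSubset.diag D T) ⟨j.1, h j.2⟩
          naturality := fun i j f => by
            have := colimit.w (DirectedSubset.diag D T)
              (homOfLE (leOfHom f) : (⟨i.1, h i.2⟩ : T.1) ⟶ ⟨j.1, h j.2⟩)
            exact this.trans (Category.comp_id _).symm } }

theorem DirectedSubset.ι_map {S T : DirectedSubset κ₁ κ₂ J} (h : S ≤ T) (j : S.1) :
    colimit.ι (DirectedSubset.diag D S) j ≫ DirectedSubset.map D h =
      colimit.ι (DirectedSubset.diag D T) ⟨j.1, h j.2⟩ :=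
  colimit.ι_desc _ _

/-- The diagram of the colimits over the directed subsets. -/
noncomputable def DirectedSubset.functor : DirectedSubset κ₁ κ₂ J ⥤ C where
  obj S := colimit (DirectedSubset.diag D S)
  map f := DirectedSubset.map D (leOfHom f)
  map_id S := colimit.hom_ext fun j =>
    (DirectedSubset.ι_map D _ j).trans (Category.comp_id _).symm
  map_comp {S T U} f g := colimit.hom_ext fun j => by
    refine (DirectedSubset.ι_map D (leOfHom (f ≫ g)) j).trans ?_
    refine (DirectedSubset.ι_map D (leOfHom g) ⟨j.1, leOfHom f j.2⟩).symm.trans ?_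
    refine (congrArg (· ≫ DirectedSubset.map D (leOfHom g))
      (DirectedSubset.ι_map D (leOfHom f) j)).symm.trans ?_
    exact Category.assoc _ _ _

-- Singletons are directed, so a cocone over the subset colimits restricts to a cocone on `D`, and
-- this restriction determines it.
set_option maxHeartbeats 800000 in
theorem DirectedSubset.exists_isColimit [Fact κ₂.IsRegular] (c : Cocone D) (hc : IsColimit c) :
    ∃ ι : DirectedSubset.functor (κ₁ := κ₁) (κ₂ := κ₂) D ⟶
      (Functor.const (DirectedSubset κ₁ κ₂ J)).obj c.pt,
      Nonempty (IsColimit (Cocone.mk c.pt ι)) := by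
  let a (S : DirectedSubset κ₁ κ₂ J) : colimit (DirectedSubset.diag D S) ⟶ c.pt :=
    colimit.desc (DirectedSubset.diag D S) (c.whisker _)
  have ha (S : DirectedSubset κ₁ κ₂ J) (j : S.1) :
      colimit.ι (DirectedSubset.diag D S) j ≫ a S = c.ι.app j.1 := colimit.ι_desc _ _
  refine ⟨{ app := a, naturality := fun S T f => ?_ }, ⟨?_⟩⟩
  · refine colimit.hom_ext fun j => ?_
    refine (Category.assoc _ _ _).symm.trans ?_
    refine (congrArg (· ≫ a T) (DirectedSubset.ι_map D (leOfHom f) j)).trans ?_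
    refine (ha T _).trans ?_
    refine (ha S j).symm.trans ?_
    exact congrArg _ (Category.comp_id _).symm
  · let b (s : Cocone (DirectedSubset.functor (κ₁ := κ₁) (κ₂ := κ₂) D)) (j : J) : D.obj j ⟶ s.pt :=
      colimit.ι (DirectedSubset.diag D (DirectedSubset.single κ₁ κ₂ j)) ⟨j, rfl⟩ ≫
        s.ι.app (DirectedSubset.single κ₁ κ₂ j)
    have hb (s : Cocone (DirectedSubset.functor (κ₁ := κ₁) (κ₂ := κ₂) D))
        (S : DirectedSubset κ₁ κ₂ J) (j : S.1) :
        colimit.ι (DirectedSubset.diag D S) j ≫ s.ι.app S = b s j.1 := by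
      have hle : DirectedSubset.single κ₁ κ₂ j.1 ≤ S := by
        rintro _ rfl
        exact j.2
      have h₁ : DirectedSubset.map D hle ≫ s.ι.app S = s.ι.app (DirectedSubset.single κ₁ κ₂ j.1) :=
        s.w (homOfLE hle)
      have h₂ := DirectedSubset.ι_map D hle ⟨j.1, rfl⟩
      exact (congrArg (· ≫ s.ι.app S) h₂).symm.trans
        ((Category.assoc _ _ _).trans (congrArg _ h₁))
    let e (s : Cocone (DirectedSubset.functor (κ₁ := κ₁) (κ₂ := κ₂) D)) : Cocone D :=
      { pt := s.pt
        ι :=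
          { app := b s
            naturality := fun i j f => by
              -- Since `i ≤ j`, the pair `{i, j}` has `j` as greatest element and is directed;
              -- inside it the two legs can be compared.
              obtain ⟨S, hS⟩ : ∃ S : DirectedSubset κ₁ κ₂ J, i ∈ S.1 ∧ j ∈ S.1 := by
                refine ⟨⟨{i, j}, isCardinalFiltered_preorder _ _ fun _ k _ =>
                  ⟨⟨j, by simp⟩, fun x => ?_⟩, hasCardinalLT_of_finite _ _ (IsRegular.aleph0_le Fact.out)⟩,
                  by simp, by simp⟩
                obtain h | h := (k x).2
                · exact h.le.trans (leOfHom f)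
                · exact h.le
              have h₁ := colimit.w (DirectedSubset.diag D S)
                (homOfLE (leOfHom f) : (⟨i, hS.1⟩ : S.1) ⟶ ⟨j, hS.2⟩)
              have h₂ : D.map f ≫ colimit.ι (DirectedSubset.diag D S) ⟨j, hS.2⟩ =
                colimit.ι (DirectedSubset.diag D S) ⟨i, hS.1⟩ := h₁
              refine Eq.trans ?_ (Category.comp_id _).symm
              refine (congrArg (D.map f ≫ ·) (hb s S ⟨j, hS.2⟩).symm).trans ?_
              refine (Category.assoc _ _ _).symm.trans ?_
              exact (congrArg (· ≫ s.ι.app S) h₂).trans (hb s S ⟨i, hS.1⟩) } }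
    have ha' (j : J) : colimit.ι (DirectedSubset.diag D (DirectedSubset.single κ₁ κ₂ j)) ⟨j, rfl⟩ ≫
        a (DirectedSubset.single κ₁ κ₂ j) = c.ι.app j := ha (DirectedSubset.single κ₁ κ₂ j) ⟨j, rfl⟩
    exact
      { desc := fun s => hc.desc (e s)
        fac := fun s S => colimit.hom_ext fun j => by
          refine (Category.assoc _ _ _).symm.trans ?_
          refine (congrArg (· ≫ hc.desc (e s)) (ha S j)).trans ?_
          exact (hc.fac (e s) j.1).trans (hb s S j).symm
        uniq := fun s m hm => hc.uniq (e s) m fun j => by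
          refine (congrArg (· ≫ m) (ha' j)).symm.trans ?_
          refine (Category.assoc _ _ _).trans ?_
          exact congrArg _ (hm (DirectedSubset.single κ₁ κ₂ j)) }

/-- Raising the index of accessibility: each object of a `κ₁`-accessible category is a `κ₂`-directed
colimit of objects from an essentially small class. -/
theorem exists_essentiallySmall_colimitsOfShape (C : Type v) [Category.{u} C]
    [Fact κ₂.IsRegular] [IsCardinalAccessibleCategory C κ₁] (h : κ₁ < κ₂)
    (hY : ∀ X : Type u, HasCardinalLT X κ₂ →
      ∃ Y : Set (SetCardinalLT κ₁ X), HasCardinalLT Y κ₂ ∧ IsCofinal Y) :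
    ∃ P : ObjectProperty C, ObjectProperty.EssentiallySmall.{u} P ∧
      ∀ X : C, ∃ (T : Type u) (_ : PartialOrder T) (_ : IsCardinalFiltered T κ₂),
        P.colimitsOfShape T X := by
  obtain ⟨P, _, hP⟩ := HasCardinalFilteredGenerator.exists_generator C κ₁
  -- Closing the generator under colimits of size less than `κ₂` keeps it essentially small and
  -- captures the colimit over every directed subset.
  refine ⟨P.colimitsCardinalClosure κ₂, inferInstance, fun X => ?_⟩
  obtain ⟨J', _, _, ⟨p'⟩⟩ := hP.exists_colimitsOfShape X
  obtain ⟨J, _, _, F, _⟩ := IsCardinalFiltered.exists_cardinal_directed J' κ₁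
  let p := p'.reindex F
  obtain ⟨ι, ⟨hι⟩⟩ := DirectedSubset.exists_isColimit (κ₁ := κ₁) (κ₂ := κ₂) p.diag _ p.isColimit
  refine ⟨DirectedSubset κ₁ κ₂ J, inferInstance,
    DirectedSubset.isCardinalFiltered h hY,
    ⟨{ diag := DirectedSubset.functor p.diag
       ι := ι
       isColimit := hι
       prop_diag_obj := fun S => ?_ }⟩⟩
  have hS : HasCardinalLT (Arrow S.1) κ₂ := by
    have h₂ : ℵ₀ ≤ κ₂ := IsRegular.aleph0_le Fact.out
    refine (hasCardinalLT_prod h₂ S.2.2 S.2.2).of_injective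
      (fun f : Arrow S.1 => (f.left, f.right)) ?_
    rintro ⟨a, b, f⟩ ⟨a', b', f'⟩ hff
    obtain ⟨rfl, rfl⟩ : a = a' ∧ b = b' := Prod.ext_iff.1 hff
    rw [Subsingleton.elim f f']
  have := P.isClosedUnderColimitsOfShape_colimitsCardinalClosure κ₂ S.1 hS
  exact (P.colimitsCardinalClosure κ₂).prop_colimit (DirectedSubset.diag p.diag S)
    fun j => P.le_colimitsCardinalClosure κ₂ _ (p.prop_diag_obj j.1)

end Category

/-! ### Squares over an identity are independent. -/

section Independence

variable {C : Type v} [Category.{u} C] {I : IndepRel C}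

/-- Over an identity the second leg is determined by the first. Amalgamating the first legs of two
such squares therefore makes the squares equivalent, and existence supplies an independent one. -/
theorem IndepRel.Existence.indep_right_id (hE : I.Existence) {M₀ M₁ N : C} (f : M₀ ⟶ M₁)
    (g₁ : M₁ ⟶ N) (g₂ : M₀ ⟶ N) (w : f ≫ g₁ = 𝟙 M₀ ≫ g₂) :
    I.indep (⟨N, g₁, g₂, w⟩ : Amalgam f (𝟙 M₀)) := by
  obtain ⟨a, ha⟩ := hE f (𝟙 M₀)
  obtain ⟨b, -⟩ := hE a.g₁ g₁
  refine I.closed a _ (Relation.TransGen.single ⟨b.N, b.g₁, b.g₂, b.w, ?_⟩) ha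
  have h₁ := a.w
  rw [Category.id_comp] at h₁ w
  change a.g₂ ≫ b.g₁ = g₂ ≫ b.g₂
  rw [← h₁, ← w, Category.assoc, Category.assoc, b.w]

theorem IndepRel.Existence.indep_left_id (hE : I.Existence) {M₀ M₂ N : C} (f : M₀ ⟶ M₂)
    (g₁ : M₀ ⟶ N) (g₂ : M₂ ⟶ N) (w : 𝟙 M₀ ≫ g₁ = f ≫ g₂) :
    I.indep (⟨N, g₁, g₂, w⟩ : Amalgam (𝟙 M₀) f) := by
  obtain ⟨a, ha⟩ := hE (𝟙 M₀) f
  obtain ⟨b, -⟩ := hE a.g₂ g₂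
  refine I.closed a _ (Relation.TransGen.single ⟨b.N, b.g₁, b.g₂, ?_, b.w⟩) ha
  have h₁ := a.w
  rw [Category.id_comp] at h₁ w
  change a.g₁ ≫ b.g₁ = g₁ ≫ b.g₂
  rw [h₁, w, Category.assoc, Category.assoc, b.w]

variable [I.nf.IsMultiplicative]

/-- A morphism from an identity to an object of `K_NF`. -/
def IndepRel.Existence.fromId (hE : I.Existence) {P : C} {X : WideSubcategory I.nf} (h : P ⟶ X.obj.left) :
    (⟨Arrow.mk (𝟙 P)⟩ : WideSubcategory I.nf) ⟶ X :=
  ⟨Arrow.homMk h (h ≫ X.obj.hom) (by simp), hE.indep_left_id _ _ _ _⟩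

end Independence

/-! ### Substructures, isomorphisms and small families of members. -/

section Structures

variable {μ : Cardinal.{u}} {τ : Vocabulary μ}

/-- The substructure on a subset that is closed under the functions. -/
def Str.sub (M : Str τ) (S : Set M.carrier)
    (hS : ∀ (s : τ.Fun) (x : τ.funArity s → M.carrier), (∀ i, x i ∈ S) → M.funMap s x ∈ S) :
    Str τ where
  carrier := S
  funMap s x := ⟨M.funMap s fun i => (x i).1, hS s _ fun i => (x i).2⟩
  relMap r x := M.relMap r fun i => (x i).1

/-- The inclusion of a substructure. -/
def Str.sub.incl (M : Str τ) (S : Set M.carrier)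
    (hS : ∀ (s : τ.Fun) (x : τ.funArity s → M.carrier), (∀ i, x i ∈ S) → M.funMap s x ∈ S) :
    Emb (M.sub S hS) M where
  toFun := Subtype.val
  injective := Subtype.val_injective
  map_fun _ _ := rfl
  map_rel _ _ := Iff.rfl

/-- The corestriction of an embedding to a substructure that contains its range. -/
def Str.sub.lift {X M : Str τ} {S : Set M.carrier}
    (hS : ∀ (s : τ.Fun) (x : τ.funArity s → M.carrier), (∀ i, x i ∈ S) → M.funMap s x ∈ S)
    (e : Emb X M) (he : ∀ x, e.toFun x ∈ S) : Emb X (M.sub S hS) where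
  toFun x := ⟨e.toFun x, he x⟩
  injective _ _ h := e.injective (congrArg Subtype.val h)
  map_fun s x := Subtype.ext (e.map_fun s x)
  map_rel r x := e.map_rel r x

/-- The inverse of a surjective embedding. -/
noncomputable def Emb.symm {M N : Str τ} (e : Emb M N) (he : Function.Surjective e.toFun) :
    Emb N M where
  toFun := Function.surjInv he
  injective := Function.injective_surjInv he
  map_fun s x := by
    apply e.injective
    rw [Function.surjInv_eq he, e.map_fun]
    simp only [Function.surjInv_eq he]
  map_rel r x := by
    rw [e.map_rel]
    simp only [Function.surjInv_eq he]

/-- The structure on `s` that is transported along an equivalence. -/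
def Str.transport (M : Str τ) {s : Type u} (e : M.carrier ≃ s) : Str τ where
  carrier := s
  funMap t x := e (M.funMap t fun i => e.symm (x i))
  relMap r x := M.relMap r fun i => e.symm (x i)

/-- The isomorphism onto the transported structure. -/
def Str.toTransport (M : Str τ) {s : Type u} (e : M.carrier ≃ s) : Emb M (M.transport e) where
  toFun := e
  injective := e.injective
  map_fun t x := by simp [Str.transport]
  map_rel t x := by simp [Str.transport]

variable {K : AbstractClass τ}

theorem AbstractClass.hom_ext {M N : K.Obj} {f g : M ⟶ N}
    (h : ∀ x, AbstractClass.fn f x = AbstractClass.fn g x) : f = g :=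
  AbstractClass.Hom.ext (Emb.ext (funext h))

/-- A surjective `K`-embedding is an isomorphism. -/
noncomputable def AbstractClass.isoOfSurjective {M N : K.Obj} (f : M ⟶ N)
    (hf : Function.Surjective (AbstractClass.fn f)) : M ≅ N where
  hom := f
  inv := ⟨f.emb.symm hf, K.isEmb_of_surjective _ N.mem fun x =>
    ⟨AbstractClass.fn f x, Function.leftInverse_surjInv ⟨f.emb.injective, hf⟩ x⟩⟩
  hom_inv_id := AbstractClass.hom_ext fun x =>
    Function.leftInverse_surjInv ⟨f.emb.injective, hf⟩ x
  inv_hom_id := AbstractClass.hom_ext fun x => Function.surjInv_eq hf x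

theorem AbstractClass.fn_surjective {M N : K.Obj} (f : M ⟶ N) [IsIso f] :
    Function.Surjective (AbstractClass.fn f) := fun x =>
  ⟨AbstractClass.fn (inv f) x, by
    rw [← AbstractClass.fn_comp, IsIso.inv_hom_id]
    rfl⟩

variable (K)

/-- Up to isomorphism, there is only a set of members of bounded cardinality. -/
theorem AbstractClass.exists_small_family (ν : Cardinal.{u}) :
    ∃ (ι : Type u) (F : ι → K.Obj), ∀ P : K.Obj, #P.U ≤ ν → ∃ i, Nonempty (F i ≅ P) := by
  -- All structures whose universe is a subset of a fixed set of size `ν`.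
  let B : Type u := Σ s : Set ν.out, (∀ f : τ.Fun, (τ.funArity f → s) → s) ×
    (∀ r : τ.Rel, (τ.relArity r → s) → Prop)
  let str (b : B) : Str τ := ⟨b.1, b.2.1, b.2.2⟩
  refine ⟨{b : B // K.mem (str b)}, fun b => ⟨str b.1, b.2⟩, fun P hP => ?_⟩
  rw [← mk_out ν] at hP
  obtain ⟨e⟩ := hP
  let e' : P.U ≃ Set.range e := Equiv.ofInjective e e.injective
  let Q : Str τ := P.str.transport e'
  have hf := K.isEmb_of_surjective (P.str.toTransport e') P.mem e'.surjective
  have hQ : K.mem Q := K.mem_right _ hf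
  refine ⟨⟨⟨Set.range e, Q.funMap, Q.relMap⟩, hQ⟩, ⟨?_⟩⟩
  exact (AbstractClass.isoOfSurjective
    (⟨P.str.toTransport e', hf⟩ : P ⟶ (⟨Q, hQ⟩ : K.Obj)) e'.surjective).symm

end Structures

/-! ### Colimits in `K_NF` are covered by their stages; local character. -/

section LocalCharacter

variable {μ : Cardinal.{u}} {τ : Vocabulary μ} {K : AbstractClass τ}

/-- The Löwenheim-Skolem-Tarski axiom for singletons has a uniform size bound, and members of
bounded size form a set up to isomorphism. -/
theorem AbstractClass.IsMuAEC.exists_small_cover (hK : K.IsMuAEC) :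
    ∃ (ι : Type u) (F : ι → K.Obj), ∀ (M : K.Obj) (x : M.U), ∃ (i : ι) (h : F i ⟶ M),
      x ∈ Set.range (AbstractClass.fn h) := by
  obtain ⟨lam, -, -, hlst⟩ := hK.lst
  obtain ⟨ι, F, hF⟩ := K.exists_small_family ((1 : Cardinal.{u}) ^< μ + lam)
  refine ⟨ι, F, fun M x => ?_⟩
  obtain ⟨M₀, f, hf, hx, hc⟩ := hlst M.str M.mem {x}
  rw [mk_singleton] at hc
  obtain ⟨i, ⟨e⟩⟩ := hF ⟨M₀, K.mem_left f hf⟩ hc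
  refine ⟨i, e.hom ≫ ⟨f, hf⟩, ?_⟩
  obtain ⟨y, hy⟩ := hx rfl
  obtain ⟨z, hz⟩ := AbstractClass.fn_surjective e.hom y
  refine ⟨z, ?_⟩
  rw [AbstractClass.fn_comp, hz]
  exact hy

variable {I : IndepRel K.Obj} [I.nf.IsMultiplicative]

theorem IndepRel.hom_left_congr {X Y : WideSubcategory I.nf} {f g : X ⟶ Y} (h : f = g) :
    f.hom.left = g.hom.left := by
  rw [h]

theorem IndepRel.hom_right_congr {X Y : WideSubcategory I.nf} {f g : X ⟶ Y} (h : f = g) :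
    f.hom.right = g.hom.right := by
  rw [h]

theorem exists_isCardinalPresentable [IsAccessibleCategory.{u} (WideSubcategory I.nf)]
    {ι : Type u} (F : ι → WideSubcategory I.nf) :
    ∃ κ₀ : Cardinal.{u}, ∀ κ : Cardinal.{u}, κ₀ ≤ κ → ∀ [Fact κ.IsRegular], ∀ i,
      IsCardinalPresentable (F i) κ := by
  have h (i : ι) : ∃ (κ : Cardinal.{u}) (_ : Fact κ.IsRegular), IsCardinalPresentable (F i) κ :=
    (inferInstance : IsPresentable.{u} (F i)).exists_cardinal
  choose k hk hk' using h
  refine ⟨iSup k, fun κ hκ _ i => ?_⟩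
  have := hk i
  have := hk' i
  exact isCardinalPresentable_of_le (F i)
    ((le_ciSup (bddAbove_of_small (s := Set.range k)) i).trans hκ)

variable {T : Type u} [PartialOrder T] {κ : Cardinal.{u}} [Fact κ.IsRegular]
  [IsCardinalFiltered T κ] {E : T ⥤ WideSubcategory I.nf} {c : Cocone E}

/-- Any map from `P` to the domain of `X` gives a morphism from `𝟙 P` to `X` in `K_NF`.
Presentability of the identities of a covering family thus factors a small model around `x` through
a stage. -/
theorem IndepRel.Existence.exists_left_of_isColimit (hE : I.Existence) (hc : IsColimit c)
    {ι : Type u} {F : ι → K.Obj}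
    (hF : ∀ (M : K.Obj) (x : M.U), ∃ (i : ι) (h : F i ⟶ M), x ∈ Set.range (AbstractClass.fn h))
    (hP : ∀ i, IsCardinalPresentable (⟨Arrow.mk (𝟙 (F i))⟩ : WideSubcategory I.nf) κ)
    (x : c.pt.obj.left.U) :
    ∃ (t : T) (y : (E.obj t).obj.left.U), AbstractClass.fn (c.ι.app t).hom.left y = x := by
  obtain ⟨i, h, y, rfl⟩ := hF _ x
  have := hP i
  obtain ⟨t, f, hf⟩ := IsCardinalPresentable.exists_hom_of_isColimit κ hc (hE.fromId h)
  refine ⟨t, AbstractClass.fn f.hom.left y, ?_⟩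
  rw [← AbstractClass.fn_comp]
  have : f.hom.left ≫ (c.ι.app t).hom.left = h :=
    IndepRel.hom_left_congr hf
  rw [this]

/-- The images of the stages have a union `N'` in the class, and the colimit morphism corestricts to
`N'`. The corestriction is again the point of a cocone in `K_NF`, so the universal property splits
the inclusion of `N'`, which is therefore onto. -/
theorem exists_right_of_isColimit (hK : K.IsMuAEC) (hE : I.Existence) (hμ : μ ≤ κ)
    (hc : IsColimit c)
    (hl : ∀ x : c.pt.obj.left.U, ∃ (t : T) (y : (E.obj t).obj.left.U),
      AbstractClass.fn (c.ι.app t).hom.left y = x)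
    (x : c.pt.obj.right.U) :
    ∃ (t : T) (y : (E.obj t).obj.right.U), AbstractClass.fn (c.ι.app t).hom.right y = x := by
  let n (t : T) : (E.obj t).obj.right ⟶ c.pt.obj.right := (c.ι.app t).hom.right
  let N : Str τ := c.pt.obj.right.str
  have hn {s t : T} (hst : s ≤ t) : (E.map (homOfLE hst)).hom.right ≫ n t = n s :=
    IndepRel.hom_right_congr (c.w (homOfLE hst))
  let S : Set N.carrier := {x | ∃ t y, AbstractClass.fn (n t) y = x}
  -- Arities are below `μ ≤ κ`, so all arguments of a function symbol come from one stage.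
  have hS (s : τ.Fun) (x : τ.funArity s → N.carrier) (hx : ∀ i, x i ∈ S) : N.funMap s x ∈ S := by
    choose t y hy using hx
    have hs : HasCardinalLT (τ.funArity s) κ := by
      rw [hasCardinalLT_iff_cardinal_mk_lt]
      exact (τ.funArity_lt s).trans_le hμ
    let m := IsCardinalFiltered.max t hs
    have ht (i) : t i ≤ m := leOfHom (IsCardinalFiltered.toMax t hs i)
    refine ⟨m, (E.obj m).obj.right.str.funMap s
      fun i => AbstractClass.fn (E.map (homOfLE (ht i))).hom.right (y i), ?_⟩
    refine ((n m).emb.map_fun s _).trans (congrArg _ (funext fun i => ?_))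
    refine Eq.trans ?_ (hy i)
    rw [← hn (ht i)]
    rfl
  have hdir : IsCardDirected μ T := by
    intro s hs
    have hs' : HasCardinalLT s κ := by
      rw [hasCardinalLT_iff_cardinal_mk_lt]
      exact hs.trans_le hμ
    refine ⟨IsCardinalFiltered.max (fun x : s => x.1) hs', fun t ht => ?_⟩
    exact leOfHom (IsCardinalFiltered.toMax (fun x : s => x.1) hs' ⟨t, ht⟩)
  have hunion := hK.chain T hdir (fun t => (E.obj t).obj.right.str)
    (fun s t h => (E.map (homOfLE h)).hom.right.emb)
    (fun s t h => (E.map (homOfLE h)).hom.right.isEmb)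
    (N.sub S hS) (fun t => Str.sub.lift hS (n t).emb fun y => ⟨t, y, rfl⟩)
    ⟨fun s t h => Emb.ext (funext fun y => Subtype.ext
      (congrArg (fun g => AbstractClass.fn g y) (hn h))),
      fun x => by
        obtain ⟨x, t, y, rfl⟩ := x
        exact ⟨t, y, rfl⟩⟩
  obtain ⟨hmem, hg, hup⟩ := hunion
  let N' : K.Obj := ⟨N.sub S hS, hmem⟩
  let incl : N' ⟶ c.pt.obj.right :=
    ⟨Str.sub.incl N S hS, hup N (Str.sub.incl N S hS) fun t => (n t).isEmb⟩
  let g (t : T) : (E.obj t).obj.right ⟶ N' := ⟨_, hg t⟩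
  have hg' (t : T) : g t ≫ incl = n t := rfl
  have hsq (t : T) : (c.ι.app t).hom.left ≫ c.pt.obj.hom = (E.obj t).obj.hom ≫ n t :=
    (c.ι.app t).hom.w
  have hrange (y : c.pt.obj.left.U) : AbstractClass.fn c.pt.obj.hom y ∈ S := by
    obtain ⟨t, z, rfl⟩ := hl y
    exact ⟨t, AbstractClass.fn (E.obj t).obj.hom z,
      (congrArg (fun g => AbstractClass.fn g z) (hsq t)).symm⟩
  let f' : c.pt.obj.left ⟶ N' :=
    ⟨Str.sub.lift hS c.pt.obj.hom.emb hrange, hK.coherence _ incl.emb incl.isEmb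
      c.pt.obj.hom.isEmb⟩
  have hf' : f' ≫ incl = c.pt.obj.hom := rfl
  have hincl : ∀ {X : K.Obj} {a b : X ⟶ N'}, a ≫ incl = b ≫ incl → a = b := fun {X a b} hab =>
    AbstractClass.hom_ext fun z => AbstractClass.fn_injective incl
      (congrArg (fun g => AbstractClass.fn g z) hab)
  -- Each square into `f'` is independent because composing with `incl` makes it equivalent to the
  -- original one.
  let c' : Cocone E :=
    { pt := ⟨Arrow.mk f'⟩
      ι :=
        { app := fun t => ⟨Arrow.homMk (c.ι.app t).hom.left (g t) (hincl (by
            rw [Category.assoc, Category.assoc, hg']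
            exact hsq t)), I.closed
              ⟨c.pt.obj.right, n t, c.pt.obj.hom, (hsq t).symm⟩ _ (Relation.TransGen.single
              ⟨c.pt.obj.right, 𝟙 _, incl, Category.comp_id _, Category.comp_id _⟩) (c.ι.app t).property⟩
          naturality := fun s t h => WideSubcategory.hom_ext _ (Arrow.hom_ext _ _
            (IndepRel.hom_left_congr (c.ι.naturality h) :)
            (hincl (by
              have := IndepRel.hom_right_congr (c.ι.naturality h)
              exact this))) } }
  -- The domain component is an identity, so this square is independent and `j` lives in `K_NF`.
  let j : c'.pt ⟶ c.pt :=
    ⟨Arrow.homMk (𝟙 c.pt.obj.left) incl (by exact (Category.id_comp _).trans hf'.symm),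
      hE.indep_right_id _ _ _ _⟩
  have hj : hc.desc c' ≫ j = 𝟙 c.pt := hc.hom_ext fun t => by
    rw [← Category.assoc, hc.fac, Category.comp_id]
    exact WideSubcategory.hom_ext _ (Arrow.hom_ext _ _ (Category.comp_id _) (hg' t))
  have hj' : (hc.desc c').hom.right ≫ incl = 𝟙 c.pt.obj.right :=
    IndepRel.hom_right_congr hj
  have hx : AbstractClass.fn incl (AbstractClass.fn (hc.desc c').hom.right x) = x :=
    congrArg (fun g => AbstractClass.fn g x) hj'
  rw [← hx]
  exact (AbstractClass.fn (hc.desc c').hom.right x).2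

/-- Local character: for each `θ` there is a set of morphisms such that each set of at most `θ`
elements of the codomain of a morphism `f` is covered by an independent square from a member of the
set to `f`. -/
theorem exists_local_character (hK : K.IsMuAEC) (hE : I.Existence)
    [IsAccessibleCategory.{u} (WideSubcategory I.nf)] (θ : Cardinal.{u}) :
    ∃ (ι : Type u) (G : ι → Arrow K.Obj), ∀ (f : Arrow K.Obj) (A : Set f.right.U), #A ≤ θ →
      ∃ (i : ι) (h : G i ⟶ f), I.nf h ∧ A ⊆ Set.range (AbstractClass.fn h.right) := by
  obtain ⟨ι₀, F, hF⟩ := hK.exists_small_cover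
  obtain ⟨κ₀, hκ₀⟩ := exists_isCardinalPresentable
    (fun i => (⟨Arrow.mk (𝟙 (F i))⟩ : WideSubcategory I.nf))
  obtain ⟨κ₁, _, _⟩ := IsAccessibleCategory.exists_cardinal.{u} (WideSubcategory I.nf)
  have hκ₁ : ℵ₀ ≤ κ₁ := IsRegular.aleph0_le Fact.out
  let b : Cardinal.{u} := max (max κ₀ κ₁) (max θ μ)
  have h₁b : κ₁ ≤ b := (le_max_right _ _).trans (le_max_left _ _)
  -- As `κ₁ ≤ b`, this gives `ν ^ κ₁ ≤ ν`, so `κ₁` is sharply below the regular cardinal `ν⁺`, which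
  -- also exceeds `κ₀`, `θ` and `μ`.
  let ν : Cardinal.{u} := 2 ^ b
  have hbν : b ≤ ν := (cantor b).le
  have h₀ν : ℵ₀ ≤ ν := hκ₁.trans (h₁b.trans hbν)
  let κ₂ : Cardinal.{u} := Order.succ ν
  have : Fact κ₂.IsRegular := ⟨isRegular_succ h₀ν⟩
  have hb₂ : b < κ₂ := Order.lt_succ_iff.2 hbν
  obtain ⟨P, _, hP⟩ := exists_essentiallySmall_colimitsOfShape (κ₁ := κ₁) (κ₂ := κ₂)
    (WideSubcategory I.nf) (h₁b.trans_lt hb₂)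
    (exists_cofinal_of_power_le (power_two_power_le (hκ₁.trans h₁b) h₁b) h₀ν)
  obtain ⟨Q, _, hQP, hPQ⟩ := ObjectProperty.EssentiallySmall.exists_small_le.{u} P
  refine ⟨Shrink.{u} (Subtype Q), fun i => ((equivShrink _).symm i).1.obj, fun f A hA => ?_⟩
  obtain ⟨T, _, _, ⟨p⟩⟩ := hP ⟨f⟩
  have hl := hE.exists_left_of_isColimit p.isColimit hF (κ := κ₂)
    fun i => hκ₀ κ₂ (((le_max_left _ _).trans (le_max_left _ _)).trans hb₂.le) i
  have hr := exists_right_of_isColimit hK hE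
    (((le_max_right _ _).trans (le_max_right _ _)).trans hb₂.le : μ ≤ κ₂) p.isColimit hl
  choose t y hy using fun x : A => hr x.1
  have hA' : HasCardinalLT A κ₂ := by
    rw [hasCardinalLT_iff_cardinal_mk_lt]
    exact (hA.trans ((le_max_left _ _).trans (le_max_right _ _))).trans_lt hb₂
  -- One stage that covers all of `A`.
  let m := IsCardinalFiltered.max t hA'
  obtain ⟨Y, hY, ⟨e⟩⟩ := hPQ _ (p.prop_diag_obj m)
  let h : Y ⟶ ⟨f⟩ := e.inv ≫ p.ι.app m
  obtain ⟨i, hi⟩ := (equivShrink (Subtype Q)).symm.surjective ⟨Y, hY⟩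
  refine ⟨i, (congrArg (fun Z : Subtype Q => ∃ k : Z.1.obj ⟶ f, I.nf k ∧
    A ⊆ Set.range (AbstractClass.fn k.right)) hi).mpr ?_⟩
  refine ⟨h.hom, h.property, fun x hx => ?_⟩
  let z := AbstractClass.fn (p.diag.map (IsCardinalFiltered.toMax t hA' ⟨x, hx⟩)).hom.right
    (y ⟨x, hx⟩)
  refine ⟨AbstractClass.fn e.hom.hom.right z, ?_⟩
  have h₁ : p.diag.map (IsCardinalFiltered.toMax t hA' ⟨x, hx⟩) ≫ e.hom ≫ h =
      p.ι.app (t ⟨x, hx⟩) := by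
    dsimp only [h]
    rw [e.hom_inv_id_assoc]
    exact p.w _
  have h₂ := congrArg (fun g => AbstractClass.fn g (y ⟨x, hx⟩)) (IndepRel.hom_right_congr h₁)
  exact h₂.trans (hy ⟨x, hx⟩)

end LocalCharacter

/-! ### Counting Galois types. -/

section GaloisTypes

variable {μ : Cardinal.{u}} {τ : Vocabulary μ} {K : AbstractClass τ}

/-- The Galois type over `M₁` that an amalgam gives to a sequence of elements of `M₂`. -/
def Amalgam.galoisType {M₀ M₁ M₂ : K.Obj} {f₁ : M₀ ⟶ M₁} {f₂ : M₀ ⟶ M₂} (x : Amalgam f₁ f₂)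
    {β : Ordinal.{u}} (c : β.ToType → M₂.U) : GaloisType M₁ β :=
  Quot.mk _ ⟨x.N, x.g₁, fun i => AbstractClass.fn x.g₂ (c i)⟩

theorem Amalgam.Equiv.galoisType_eq {M₀ M₁ M₂ : K.Obj} {f₁ : M₀ ⟶ M₁} {f₂ : M₀ ⟶ M₂}
    {x y : Amalgam f₁ f₂} (h : x.Equiv y) {β : Ordinal.{u}} (c : β.ToType → M₂.U) :
    x.galoisType c = y.galoisType c := by
  have step {x y : Amalgam f₁ f₂} (h : x.EquivStar y) : x.galoisType c = y.galoisType c := by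
    obtain ⟨N, g, g', h₁, h₂⟩ := h
    exact Quot.sound ⟨N, g, g', h₁, fun i => congrArg (fun k => AbstractClass.fn k (c i)) h₂⟩
  induction h with
  | single h => exact step h
  | tail _ h ih => exact ih.trans (step h)

/-- A family of morphisms is `θ`-covering if each set of at most `θ` elements of the codomain of a
morphism `f` is covered by an independent square from a member of the family to `f`. -/
def IndepRel.IsCovering (I : IndepRel K.Obj) (θ : Cardinal.{u}) {ι : Type u}
    (G : ι → Arrow K.Obj) : Prop :=
  ∀ (f : Arrow K.Obj) (A : Set f.right.U), #A ≤ θ →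
    ∃ (i : ι) (h : G i ⟶ f), I.nf h ∧ A ⊆ Set.range (AbstractClass.fn h.right)

variable {I : IndepRel K.Obj}

theorem IndepRel.IsStable.exists_isCovering (hI : I.IsStable) (hK : K.IsMuAEC)
    (θ : Cardinal.{u}) : ∃ (ι : Type u) (G : ι → Arrow K.Obj), I.IsCovering θ G := by
  have := I.nf_isMultiplicative hI.existence hI.rightTransitive
  have : IsAccessibleCategory.{u} (WideSubcategory I.nf) := hI.rightAccessible
  exact exists_local_character hK hI.existence θ

variable {θ : Cardinal.{u}} {ι : Type u} {G : ι → Arrow K.Obj}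

/-- The Galois type over `M` of the image of a sequence of elements of the codomain of `G i` in an
independent amalgam with `M`. -/
noncomputable def IndepRel.Existence.galoisType (hE : I.Existence) (G : ι → Arrow K.Obj)
    (M : K.Obj) (β : Ordinal.{u})
    (x : Σ i, ((G i).left ⟶ M) × (β.ToType → (G i).right.U)) : GaloisType M β :=
  (hE (G x.1).hom x.2.1).choose.swap.galoisType x.2.2

/-- The covering square and the chosen amalgam are independent over the same span, so uniqueness
gives the sequence the same type over `M` in both. -/
theorem IndepRel.IsCovering.galoisType_surjective (hG : I.IsCovering θ G) (hE : I.Existence)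
    (hU : I.Uniqueness) (M : K.Obj) (β : Ordinal.{u}) (hβ : β.card ≤ θ) :
    Function.Surjective (hE.galoisType G M β) := by
  rintro ⟨N, f, a⟩
  obtain ⟨i, h, hh, ha⟩ := hG (Arrow.mk f) (Set.range a)
    (mk_range_le.trans (by rwa [mk_toType]))
  choose a₀ ha₀ using fun i => ha ⟨i, rfl⟩
  refine ⟨⟨i, h.left, a₀⟩, ?_⟩
  have h₁ := hU _ _ (hE (G i).hom h.left).choose_spec hh
  refine (h₁.swap.galoisType_eq a₀).trans ?_
  exact congrArg (fun b => Quot.mk _ (⟨N, f, b⟩ : PreType M β)) (funext ha₀)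

theorem mk_hom_le (M N : K.Obj) : #(M ⟶ N) ≤ #N.U ^ #M.U := by
  rw [power_def]
  exact mk_le_of_injective (f := fun h : M ⟶ N => AbstractClass.fn h) fun f g h =>
    AbstractClass.hom_ext fun x => congrFun h x

/-- The data that determine a type are few: at most `ν` indices, `λ ^ ν` maps into `M` and `λ ^ ν`
sequences. -/
theorem IndepRel.IsCovering.mk_galoisType_le (hG : I.IsCovering θ G) (hE : I.Existence)
    (hU : I.Uniqueness) {ν : Cardinal.{u}} (hν : ℵ₀ ≤ ν) (hθ : θ ≤ ν) (hι : #ι ≤ ν)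
    (hl : ∀ i, #(G i).left.U ≤ ν)
    (hr : ∀ i, #(G i).right.U ≤ ν) {lam : Cardinal.{u}} (hlam : ν ≤ lam) (hpow : lam ^ ν = lam)
    (M : K.Obj) (hM : #M.U = lam) (β : Ordinal.{u}) (hβ : β.card ≤ θ) :
    #(GaloisType M β) ≤ Cardinal.lift.{u + 1} lam := by
  have h₀ : lam ≠ 0 := (aleph0_pos.trans_le (hν.trans hlam)).ne'
  have hpow' {a : Cardinal.{u}} (ha : a ≤ ν) : lam ^ a ≤ lam :=
    (power_le_power_left h₀ ha).trans hpow.le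
  have h₁ := mk_le_of_surjective
    ((hG.galoisType_surjective hE hU M β hβ).comp Equiv.ulift.{u + 1}.surjective)
  refine h₁.trans ?_
  rw [mk_uLift, Cardinal.lift_le, mk_sigma]
  calc Cardinal.sum (fun i => #(((G i).left ⟶ M) × (β.ToType → (G i).right.U)))
      ≤ Cardinal.sum (fun _ : ι => lam) := sum_le_sum _ _ fun i => by
        rw [mk_prod, Cardinal.lift_id, Cardinal.lift_id, ← power_def, mk_toType]
        have h₂ : #((G i).left ⟶ M) ≤ lam := (mk_hom_le _ _).trans (by
          rw [hM]
          exact hpow' (hl i))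
        refine (mul_le_mul' h₂
          ((power_le_power_right ((hr i).trans hlam)).trans (hpow' (hβ.trans hθ)))).trans ?_
        exact (mul_eq_self (hν.trans hlam)).le
    _ = #ι * lam := by rw [sum_const']
    _ ≤ lam * lam := mul_le_mul_left (hι.trans hlam) _
    _ = lam := mul_eq_self (hν.trans hlam)

theorem mk_galoisTypeLT_le {lam : Cardinal.{u}} {α : Ordinal.{u}} (hlam : ℵ₀ ≤ lam)
    (hα : α.card ≤ lam) (M : K.Obj)
    (h : ∀ β : Ordinal.{u}, β.card ≤ α.card →
      #(GaloisType M β) ≤ Cardinal.lift.{u + 1} lam) :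
    #(GaloisTypeLT M α) ≤ Cardinal.lift.{u + 1} lam := by
  rw [GaloisTypeLT, mk_sigma]
  calc Cardinal.sum (fun β : Set.Iio α => #(GaloisType M β.1))
      ≤ Cardinal.sum (fun _ : Set.Iio α => Cardinal.lift.{u + 1} lam) :=
        sum_le_sum _ _ fun β => h β.1 (Ordinal.card_le_card (le_of_lt β.2))
    _ = #(Set.Iio α) * Cardinal.lift.{u + 1} lam := by rw [sum_const']
    _ ≤ Cardinal.lift.{u + 1} lam * Cardinal.lift.{u + 1} lam := by
        refine mul_le_mul_left ?_ _
        rw [mk_Iio_ordinal, Cardinal.lift_le]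
        exact hα
    _ = Cardinal.lift.{u + 1} lam := by rw [← Cardinal.lift_mul, mul_eq_self hlam]

/-- Distinct elements of `M` have distinct Galois types over `M`. -/
theorem lift_mk_le_mk_galoisTypeLT (M : K.Obj) {α : Ordinal.{u}} (hα : 2 ≤ α) :
    Cardinal.lift.{u + 1} #M.U ≤ #(GaloisTypeLT M α) := by
  have h₁ : (1 : Ordinal.{u}) < α := lt_of_lt_of_le one_lt_two hα
  have hne : Nonempty (1 : Ordinal.{u}).ToType := Ordinal.nonempty_toType_iff.2 one_ne_zero
  let e (x : M.U) : GaloisTypeLT M α := ⟨⟨1, h₁⟩, Quot.mk _ ⟨M, 𝟙 M, fun _ => x⟩⟩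
  have he : Function.Injective e := by
    intro x y hxy
    have hxy' : (Quot.mk _ ⟨M, 𝟙 M, fun _ => x⟩ : GaloisType M 1) =
        Quot.mk _ ⟨M, 𝟙 M, fun _ => y⟩ := eq_of_heq (Sigma.mk.inj hxy).2
    have half {p q : PreType M 1} (hpq : p.Equiv q)
        (hp : ∀ i, p.a i = AbstractClass.fn p.f x) : ∀ i, q.a i = AbstractClass.fn q.f x := by
      obtain ⟨N, g, g', h, h'⟩ := hpq
      intro i
      apply AbstractClass.fn_injective g'
      rw [← h', hp, ← AbstractClass.fn_comp, ← AbstractClass.fn_comp, h]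
    -- "The sequence is the image of `x`" is an invariant of the type, as morphisms are injective.
    let Q : GaloisType M 1 → Prop := Quot.lift (fun p => ∀ i, p.a i = AbstractClass.fn p.f x)
      fun p q hpq => propext ⟨half hpq, half (by
        obtain ⟨N, g, g', h, h'⟩ := hpq
        exact ⟨N, g', g, h.symm, fun i => (h' i).symm⟩)⟩
    have h₂ : Q (Quot.mk _ ⟨M, 𝟙 M, fun _ => y⟩) := by
      rw [← hxy']
      exact fun _ => rfl
    exact (h₂ hne.some).symm
  rw [← mk_uLift]
  exact mk_le_of_injective (he.comp Equiv.ulift.injective)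

/-! ### Tameness -/

/-- An extension of the inclusion of `A` into the model of a representative of a Galois type over
`A`, along a map from `A` to the universe of `M₀`. -/
def SetPreType.IsExt {A : Type u} {β : Ordinal.{u}} {M₀ : K.Obj} (e : M₀.U → A)
    (s : SetPreType K A β) (k : M₀ ⟶ s.N) : Prop :=
  ∀ x, AbstractClass.fn k x = s.incl (e x)

/-- Since `g` and `g'` agree on `A`, the map `k ≫ g` factors through `g'`; coherence makes the
factor a `K`-embedding. -/
theorem SetPreType.Equiv.exists_isExt (hK : K.IsMuAEC) {A : Type u} {β : Ordinal.{u}} {M₀ : K.Obj}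
    {e : M₀.U → A} {s s' : SetPreType K A β} (h : s.Equiv s') {k : M₀ ⟶ s.N} (hk : s.IsExt e k) :
    ∃ k' : M₀ ⟶ s'.N, s'.IsExt e k' := by
  obtain ⟨Q, g, g', h, -⟩ := h
  have hgg (x : M₀.U) : AbstractClass.fn (k ≫ g) x = AbstractClass.fn g' (s'.incl (e x)) := by
    rw [← h, ← hk]
    rfl
  let k' : Emb M₀.str s'.N.str :=
    { toFun := fun x => s'.incl (e x)
      injective := fun x y hxy => AbstractClass.fn_injective (k ≫ g) (by
        rw [hgg, hgg]
        exact congrArg _ hxy)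
      map_fun := fun t x => AbstractClass.fn_injective g' (by
        rw [← hgg]
        refine ((k ≫ g).emb.map_fun t x).trans ?_
        refine Eq.trans ?_ (g'.emb.map_fun t _).symm
        exact congrArg _ (funext fun i => hgg (x i)))
      map_rel := fun r x => by
        refine ((k ≫ g).emb.map_rel r x).trans ?_
        refine Iff.trans ?_ (g'.emb.map_rel r _).symm
        exact iff_of_eq (congrArg _ (funext fun i => hgg (x i))) }
  have hk' : k'.comp g'.emb = (k ≫ g).emb := Emb.ext (funext fun x => (hgg x).symm)
  exact ⟨⟨k', hK.coherence k' g'.emb g'.isEmb (hk' ▸ (k ≫ g).isEmb)⟩, fun x => rfl⟩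

/-- If two representatives have the same Galois type over a set that carries a model `M₀`, then they
are identified in an amalgam over `M₀`. -/
theorem exists_amalgam_of_setGaloisType_eq (hK : K.IsMuAEC) (hE : I.Existence) {A : Type u}
    {β : Ordinal.{u}} {M₀ : K.Obj} {e : M₀.U → A} {s s' : SetPreType K A β}
    (h : (Quot.mk _ s : SetGaloisType K A β) = Quot.mk _ s') {k : M₀ ⟶ s.N} {k' : M₀ ⟶ s'.N}
    (hk : s.IsExt e k) (hk' : s'.IsExt e k') :
    ∃ (Q : K.Obj) (u : s.N ⟶ Q) (v : s'.N ⟶ Q), k ≫ u = k' ≫ v ∧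
      ∀ i, AbstractClass.fn u (s.a i) = AbstractClass.fn v (s'.a i) := by
  -- Equality of types is only a chain of amalgams. The induction also carries the existence of an
  -- extension, so that every intermediate representative contains `M₀`.
  have key : ∀ s s' : SetPreType K A β, Relation.EqvGen SetPreType.Equiv s s' →
      ((∃ k : M₀ ⟶ s.N, s.IsExt e k) ↔ ∃ k' : M₀ ⟶ s'.N, s'.IsExt e k') ∧
      ∀ (k : M₀ ⟶ s.N) (k' : M₀ ⟶ s'.N), s.IsExt e k → s'.IsExt e k' →
        ∃ (Q : K.Obj) (u : s.N ⟶ Q) (v : s'.N ⟶ Q), k ≫ u = k' ≫ v ∧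
          ∀ i, AbstractClass.fn u (s.a i) = AbstractClass.fn v (s'.a i) := by
    intro s s' hss
    induction hss with
    | rel s s' h =>
      have h' : s'.Equiv s := by
        obtain ⟨Q, g, g', h₁, h₂⟩ := h
        exact ⟨Q, g', g, fun x => (h₁ x).symm, fun i => (h₂ i).symm⟩
      refine ⟨⟨fun ⟨k, hk⟩ => h.exists_isExt hK hk, fun ⟨k, hk⟩ => h'.exists_isExt hK hk⟩, ?_⟩
      intro k k' hk hk'
      obtain ⟨Q, g, g', h₁, h₂⟩ := h
      refine ⟨Q, g, g', AbstractClass.hom_ext fun x => ?_, h₂⟩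
      rw [AbstractClass.fn_comp, AbstractClass.fn_comp, hk, hk', h₁]
    | refl s =>
      refine ⟨Iff.rfl, fun k k' hk hk' => ⟨s.N, 𝟙 _, 𝟙 _, ?_, fun _ => rfl⟩⟩
      exact AbstractClass.hom_ext fun x => (hk x).trans (hk' x).symm
    | symm s s' _ ih =>
      refine ⟨ih.1.symm, fun k k' hk hk' => ?_⟩
      obtain ⟨Q, u, v, h₁, h₂⟩ := ih.2 k' k hk' hk
      exact ⟨Q, v, u, h₁.symm, fun i => (h₂ i).symm⟩
    | trans s t s' _ _ ih ih' =>
      refine ⟨ih.1.trans ih'.1, fun k k' hk hk' => ?_⟩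
      obtain ⟨l, hl⟩ := ih.1.1 ⟨k, hk⟩
      obtain ⟨Q, u, v, h₁, h₂⟩ := ih.2 k l hk hl
      obtain ⟨Q', u', v', h₁', h₂'⟩ := ih'.2 l k' hl hk'
      -- The two amalgams are glued over the intermediate model `t.N`.
      obtain ⟨b, -⟩ := hE v u'
      refine ⟨b.N, u ≫ b.g₁, v' ≫ b.g₂, ?_, fun i => ?_⟩
      · rw [← Category.assoc, h₁, Category.assoc, b.w, ← Category.assoc, h₁', Category.assoc]
      · have h₃ := congrArg (fun g => AbstractClass.fn g (t.a i)) b.w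
        simp only [AbstractClass.fn_comp] at h₃ ⊢
        rw [h₂, h₃, h₂']
  exact (key s s' (Quot.eqvGen_exact h)).2 k k' hk hk'

/-- Stacking an independent square with an independent amalgam. -/
theorem IndepRel.exists_stack (hE : I.Existence) (hT : I.RightTransitive) {M₀ M M' N Q : K.Obj}
    {l : M₀ ⟶ M} {g : M₀ ⟶ M'} {f : M ⟶ N} {r : M' ⟶ N} {w : l ≫ f = g ≫ r}
    (h : I.indep (⟨N, f, r, w⟩ : Amalgam l g)) (u : M' ⟶ Q) {q : M₀ ⟶ Q} (hq : g ≫ u = q) :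
    ∃ (x : Amalgam l q) (j : N ⟶ x.N), I.indep x ∧ f ≫ j = x.g₁ ∧ r ≫ j = u ≫ x.g₂ := by
  subst hq
  obtain ⟨b, hb⟩ := hE r u
  exact ⟨_, b.g₁, hT l g f r u b.g₁ b.g₂ w b.w h hb, rfl, b.w⟩

/-- A type is determined by its restriction to the domain of an independent square. -/
theorem galoisType_eq_of_restrict_eq (hK : K.IsMuAEC) (hI : I.IsStable) {M N : K.Obj} (f : M ⟶ N)
    {β : Ordinal.{u}} (a b : β.ToType → N.U) {g : Arrow K.Obj} (h : g ⟶ Arrow.mk f) (hh : I.nf h)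
    (ha : ∀ i, a i ∈ Set.range (AbstractClass.fn h.right))
    (hb : ∀ i, b i ∈ Set.range (AbstractClass.fn h.right))
    (hab : GaloisType.restrict (Set.range (AbstractClass.fn h.left)) (Quot.mk _ ⟨N, f, a⟩) =
      GaloisType.restrict (Set.range (AbstractClass.fn h.left)) (Quot.mk _ ⟨N, f, b⟩)) :
    (Quot.mk _ ⟨N, f, a⟩ : GaloisType M β) = Quot.mk _ ⟨N, f, b⟩ := by
  have hE : I.Existence := hI.existence
  choose a₀ ha₀ using ha
  choose b₀ hb₀ using hb
  have hw : h.left ≫ f = g.hom ≫ h.right := h.w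
  obtain ⟨Q, u, v, huv, huv'⟩ := exists_amalgam_of_setGaloisType_eq hK hE hab
    (M₀ := g.left) (e := fun x => ⟨AbstractClass.fn h.left x, x, rfl⟩)
    (k := h.left ≫ f) (k' := h.left ≫ f) (fun _ => rfl) (fun _ => rfl)
  dsimp only at u v huv huv'
  have hi : I.indep (⟨N, f, h.right, hw⟩ : Amalgam h.left g.hom) :=
    (hI.symmetric _).2 hh
  -- Both stacks below then complete the same span from `M₀` to `M` and `Q`, so uniqueness applies
  -- to them.
  have hq : g.hom ≫ h.right ≫ v = g.hom ≫ h.right ≫ u := by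
    rw [← Category.assoc, ← Category.assoc, ← hw]
    exact huv.symm
  obtain ⟨x, j, hx, hj, hj'⟩ := IndepRel.exists_stack hE hI.rightTransitive hi (h.right ≫ u) rfl
  obtain ⟨y, k, hy, hk, hk'⟩ := IndepRel.exists_stack hE hI.rightTransitive hi (h.right ≫ v) hq
  -- This sequence is also the image of `b` under `v`; it realizes the type of `a` in `x` and that
  -- of `b` in `y`.
  let c (i : β.ToType) : Q.U := AbstractClass.fn u (a i)
  have hac : (Quot.mk _ ⟨N, f, a⟩ : GaloisType M β) = x.galoisType c :=
    Quot.sound ⟨x.N, j, 𝟙 _, hj.trans (Category.comp_id _).symm, fun i => by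
      have := congrArg (fun g => AbstractClass.fn g (a₀ i)) hj'
      simp only [AbstractClass.fn_comp, ha₀] at this
      exact this⟩
  have hbc : (Quot.mk _ ⟨N, f, b⟩ : GaloisType M β) = y.galoisType c :=
    Quot.sound ⟨y.N, k, 𝟙 _, hk.trans (Category.comp_id _).symm, fun i => by
      have := congrArg (fun g => AbstractClass.fn g (b₀ i)) hk'
      simp only [AbstractClass.fn_comp, hb₀] at this
      exact this.trans (congrArg _ (huv' i).symm)⟩
  rw [hac, hbc]
  exact (hI.uniqueness x y hx hy).galoisType_eq c

/-- Amalgamating the two representatives over `M` puts both sequences in one extension, where a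
single square covers them; hence the doubled length bound. -/
theorem IndepRel.IsCovering.galoisType_eq (hG : I.IsCovering θ G) (hK : K.IsMuAEC)
    (hI : I.IsStable) {lam : Cardinal.{u}} (hlam : ∀ i, #(G i).left.U < lam) {M : K.Obj}
    {β : Ordinal.{u}} (hβ : β.card + β.card ≤ θ) (p q : GaloisType M β)
    (h : ∀ A : Set M.U, #A < lam → p.restrict A = q.restrict A) : p = q := by
  obtain ⟨N₁, f₁, a₁⟩ := p
  obtain ⟨N₂, f₂, a₂⟩ := q
  obtain ⟨x, -⟩ := hI.existence f₁ f₂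
  let f : M ⟶ x.N := f₁ ≫ x.g₁
  let a (i : β.ToType) : x.N.U := AbstractClass.fn x.g₁ (a₁ i)
  let b (i : β.ToType) : x.N.U := AbstractClass.fn x.g₂ (a₂ i)
  have h₁ : (Quot.mk _ ⟨N₁, f₁, a₁⟩ : GaloisType M β) = Quot.mk _ ⟨x.N, f, a⟩ :=
    Quot.sound ⟨x.N, x.g₁, 𝟙 _, (Category.comp_id _).symm, fun _ => rfl⟩
  have h₂ : (Quot.mk _ ⟨N₂, f₂, a₂⟩ : GaloisType M β) = Quot.mk _ ⟨x.N, f, b⟩ :=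
    Quot.sound ⟨x.N, x.g₂, 𝟙 _, x.w.symm.trans (Category.comp_id _).symm, fun _ => rfl⟩
  rw [h₁, h₂] at h ⊢
  obtain ⟨i, k, hk, hab⟩ := hG (Arrow.mk f) (Set.range a ∪ Set.range b)
    ((mk_union_le _ _).trans ((add_le_add mk_range_le mk_range_le).trans (by rwa [mk_toType])))
  exact galoisType_eq_of_restrict_eq hK hI f a b k hk (fun i => hab (Or.inl ⟨i, rfl⟩))
    (fun i => hab (Or.inr ⟨i, rfl⟩)) (h _ (mk_range_le.trans_lt (hlam i)))

end GaloisTypes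

end MuAEC

/-! ### Choice of the cardinals. -/

theorem mainTheorem11 {μ : Cardinal.{u}} (hμ : μ.IsRegular) {τ : MuAEC.Vocabulary μ}
    (K : MuAEC.AbstractClass τ) (hK : K.IsMuAEC)
    (I : MuAEC.IndepRel K.Obj) (hI : I.IsStable) :
    -- Stability for Galois types
    (∀ α : Ordinal.{u}, ∃ S : Set Cardinal.{u}, ¬ BddAbove S ∧
      ∀ lam ∈ S, ∀ M : K.Obj, Cardinal.mk M.U = lam →
        Cardinal.mk (MuAEC.GaloisTypeLT M α) ≤ Cardinal.lift.{u + 1} lam ∧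
        (2 ≤ α → Cardinal.mk (MuAEC.GaloisTypeLT M α) = Cardinal.lift.{u + 1} lam)) ∧
    -- Tameness
    (∀ α : Ordinal.{u}, ∃ lam : Cardinal.{u}, ∀ M : K.Obj, ∀ p q : MuAEC.GaloisTypeLT M α,
      p = q ↔ ∀ A : Set M.U, Cardinal.mk A < lam → p.restrict A = q.restrict A) := by
  open Cardinal in
  have hsup {ι : Type u} (F : ι → Cardinal.{u}) (i : ι) : F i ≤ iSup F :=
    le_ciSup (Cardinal.bddAbove_of_small (s := Set.range F)) i
  refine ⟨fun α => ?_, fun α => ?_⟩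
  · obtain ⟨ι, G, hG⟩ := hI.exists_isCovering hK α.card
    let ν : Cardinal.{u} :=
      max (max ℵ₀ α.card) (max #ι (max (⨆ i, #(G i).left.U) (⨆ i, #(G i).right.U)))
    have h₁ : ℵ₀ ≤ ν := (le_max_left _ _).trans (le_max_left _ _)
    have h₂ : α.card ≤ ν := (le_max_right _ _).trans (le_max_left _ _)
    have h₃ : #ι ≤ ν := (le_max_left _ _).trans (le_max_right _ _)
    have h₄ (i : ι) : #(G i).left.U ≤ ν := (hsup (fun i => #(G i).left.U) i).trans
      ((le_max_left _ _).trans ((le_max_right _ _).trans (le_max_right _ _)))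
    have h₅ (i : ι) : #(G i).right.U ≤ ν := (hsup (fun i => #(G i).right.U) i).trans
      ((le_max_right _ _).trans ((le_max_right _ _).trans (le_max_right _ _)))
    refine ⟨{lam | ν ≤ lam ∧ lam ^ ν = lam}, ?_, ?_⟩
    · rintro ⟨b, hb⟩
      have hm : ν ≤ max b ν := le_max_right _ _
      -- Powers `2 ^ κ` with `κ ≥ ν` satisfy `λ ^ ν = λ`; this one exceeds the supposed bound `b`.
      have hmem : (2 : Cardinal.{u}) ^ max b ν ∈ {lam : Cardinal.{u} | ν ≤ lam ∧ lam ^ ν = lam} :=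
        ⟨hm.trans (cantor _).le, (MuAEC.power_two_power_le (h₁.trans hm) hm).antisymm
          (self_le_power _ (one_le_aleph0.trans h₁))⟩
      exact (((le_max_left b ν).trans_lt (cantor _)).trans_le (hb hmem)).false
    · rintro lam ⟨hlam, hpow⟩ M hM
      have hle : #(MuAEC.GaloisTypeLT M α) ≤ Cardinal.lift.{u + 1} lam :=
        MuAEC.mk_galoisTypeLT_le (h₁.trans hlam) (h₂.trans hlam) M fun β hβ =>
          hG.mk_galoisType_le hI.existence hI.uniqueness h₁ h₂ h₃ h₄ h₅ hlam hpow M hM β hβ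
      exact ⟨hle, fun hα => hle.antisymm (hM ▸ MuAEC.lift_mk_le_mk_galoisTypeLT M hα)⟩
  · obtain ⟨ι, G, hG⟩ := hI.exists_isCovering hK (α.card + α.card)
    refine ⟨Order.succ (⨆ i, #(G i).left.U), fun M p q => ⟨fun h A _ => h ▸ rfl, fun h => ?_⟩⟩
    -- Restriction keeps the length, so even the empty set forces the two lengths to agree.
    have h₀ := h ∅ (by simp)
    obtain ⟨⟨β, hβ⟩, p⟩ := p
    obtain ⟨⟨β', hβ'⟩, q⟩ := q
    obtain rfl : β = β' := congrArg Subtype.val (congrArg Sigma.fst h₀)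
    have hc : β.card ≤ α.card := Ordinal.card_le_card (le_of_lt hβ)
    have hpq := hG.galoisType_eq hK hI
      (fun i => Order.lt_succ_of_le (hsup (fun i => #(G i).left.U) i)) (add_le_add hc hc) p q
      fun A hA => eq_of_heq (Sigma.mk.inj (h A hA)).2
    rw [hpq]
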